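/- Let $V$ be a Euclidean space, i.e. a finite-dimensional real inner product space, and let $\mathcal H$ be a set of hyperplanes (linear subspaces of codimension $1$) of $V$. For a hyperplane $H$ let $s_H\in GL(V)$ be the reflection along $H$, i.e. the identity on $H$ and multiplication by $-1$ on $H^\perp$. Assume that the group $W=\langle s_H : H\in\mathcal H\rangle\le GL(V)$ is finite and that $\mathcal H$ is $W$-invariant. Let $C$ be a chamber, i.e. a connected component of $V\setminus\bigcup_{H\in\mathcal H}H$, and let $H_1,\dots,H_r$ be its distinct walls, i.e. the hyperplanes $H\in\mathcal H$ such that the face $\overline C\cap H$ of $C$ spans $H$. Assume that $\dim V=r$. Put $s_i=s_{H_i}$, let $m_{ij}$ be the order of $s_is_j$, and let $M=(m_{ij})_{1\le i,j\le r}$. Then: 1. $M$ is a Coxeter matrix (symmetric, with $m_{ii}=1$ and $m_{ij}\neq 1$ for $i\ne j$), and $W$ has the Coxeter presentation given by the wall reflections: $W=\langle s_1,\dots,s_r \mid (s_is_j)^{m_{ij}}=1,\ 1\le i,j\le r\rangle$. This presentation depends only on $M$. 2. Consequently $W$ is determined up to isomorphism by $M$: if $(V',\mathcal H',C',H'_1,\dots,H'_r)$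 is another such collection of data, with group $W'$ and wall reflections $s_i'$, and its matrix $M'$ equals $M$, then there is a group isomorphism $W\to W'$ with $s_i\mapsto s'_i$ for every $i$. -/

import Mathlib

section FiniteReflectionGroups

variable {V : Type*} [NormedAddCommGroup V] [InnerProductSpace ℝ V] [FiniteDimensional ℝ V]

/-- A hyperplane: a linear subspace of codimension `1`. -/
def IsHyperplane (H : Submodule ℝ V) : Prop :=
  Module.finrank ℝ (V ⧸ H) = 1

/-- The reflection `s_H` along `H`, as an element of `GL(V)`: the linear automorphism which is the
identity on `H` and multiplication by `-1` on the orthogonal complement of `H`. -/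
noncomputable def hyperplaneReflection (H : Submodule ℝ V) : V ≃ₗ[ℝ] V :=
  H.reflection.toLinearEquiv

/-- The subgroup of `GL(V)` generated by the reflections `s_H`, `H ∈ 𝓗`. -/
def reflectionGroup (𝓗 : Set (Submodule ℝ V)) : Subgroup (V ≃ₗ[ℝ] V) :=
  Subgroup.closure (hyperplaneReflection '' 𝓗)

/-- A chamber of `𝓗`: a connected component of the complement of the union of the members
of `𝓗`. -/
def IsChamber (𝓗 : Set (Submodule ℝ V)) (C : Set V) : Prop :=
  ∃ x ∈ (⋃ H ∈ 𝓗, (H : Set V))ᶜ, C = connectedComponentIn (⋃ H ∈ 𝓗, (H : Set V))ᶜ x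

/-- The walls of `C`: the members `H` of `𝓗` such that the face `closure C ∩ H` of `C` has
codimension `1`, that is, spans `H`. -/
def walls (𝓗 : Set (Submodule ℝ V)) (C : Set V) : Set (Submodule ℝ V) :=
  {H | H ∈ 𝓗 ∧ Submodule.span ℝ (closure C ∩ (H : Set V)) = H}

/-- `𝓗` is a set of hyperplanes of `V` whose reflections generate a finite group `W`, and `𝓗` is
`W`-invariant; `C` is a chamber of `𝓗`; `H_1, …, H_r` are the distinct walls of `C`; and the
dimension of `V` is the number `r` of walls. -/
structure IsReflectionChamber (𝓗 : Set (Submodule ℝ V)) (C : Set V) {r : ℕ}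
    (H : Fin r → Submodule ℝ V) : Prop where
  hyperplane : ∀ K ∈ 𝓗, IsHyperplane K
  finite : Finite (reflectionGroup 𝓗)
  invariant : ∀ w ∈ reflectionGroup 𝓗, ∀ K ∈ 𝓗, K.map (w : V →ₗ[ℝ] V) ∈ 𝓗
  chamber : IsChamber 𝓗 C
  injective : Function.Injective H
  range_eq : Set.range H = walls 𝓗 C
  finrank_eq : Module.finrank ℝ V = r

/-- The `r × r` matrix whose entry `m_ij` is the order of `s_i s_j`, where `s_i` is the reflection
along `H_i`. -/
noncomputable def reflectionOrderMatrix {r : ℕ} (H : Fin r → Submodule ℝ V) :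
    Matrix (Fin r) (Fin r) ℕ :=
  Matrix.of fun i j => orderOf (hyperplaneReflection (H i) * hyperplaneReflection (H j))

end FiniteReflectionGroups

/-! Let p be the base point of C and α_i the unit normal of H_i positive at p. The wall reflections
satisfy the Coxeter relations, so the Coxeter group of M maps to W by some f.

f is onto: conjugating by a suitable simple reflection lowers ⟪β, p⟫ for a non-simple positive root
β, so every s_β is a product of wall reflections (`hyperplaneReflection_mem_closure_simpleRoots`).

f is injective: a left inverse g is built by recursion (`exists_equivariant_of_descents`). If ⟪α_i,
w p⟫ < 0, then s_i w p is closer to p, and g w is the i-th generator times g (s_i w). If j is also a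
descent of w, the first m_ij roots of the alternating word are nonnegative combinations of α_i and
α_j, hence negative at w p. Both alternating words of length m_ij therefore consist of descents and
end at the same element, and the braid relation makes the two values agree. -/

/-! ### Alternating words and recursion along descents -/

/-- The alternating product `a * b * a * ⋯` with `k` factors. -/
def altProd {G : Type*} [Monoid G] : G → G → ℕ → G
  | _, _, 0 => 1
  | a, b, k + 1 => a * altProd b a k

/-- The letter at position `l` of the alternating word `i, j, i, j, …`. -/
def altLetter {B : Type*} : B → B → ℕ → B
  | i, _, 0 => i
  | i, j, l + 1 => altLetter j i l

theorem mul_pow_mul_swap {G : Type*} [Monoid G] (a b : G) (k : ℕ) :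
    a * (b * a) ^ k * b = (a * b) ^ (k + 1) := by
  induction k with
  | zero => simp
  | succ k ih => rw [pow_succ', pow_succ' _ (k + 1), ← ih]; simp only [mul_assoc]

theorem altProd_mul_inv_altProd {G : Type*} [Group G] (a b : G) (hb : b * b = 1) (ha : a * a = 1)
    (k : ℕ) : altProd a b k * (altProd b a k)⁻¹ = (a * b) ^ k := by
  induction k generalizing a b with
  | zero => simp [altProd]
  | succ k ih =>
    have h := ih b a ha hb
    rw [← mul_pow_mul_swap, ← h, altProd, altProd, mul_inv_rev, inv_eq_of_mul_eq_one_left hb]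
    simp only [mul_assoc]

theorem altProd_comm {G : Type*} [Group G] {a b : G} (ha : a * a = 1) (hb : b * b = 1) {k : ℕ}
    (h : (a * b) ^ k = 1) : altProd a b k = altProd b a k := by
  rw [← altProd_mul_inv_altProd a b hb ha, mul_inv_eq_one] at h
  exact h

/-- A finite group with involutions `s i`, a notion of descent satisfying a dihedral condition, and
a function increasing along descents, admits an equivariant map to every group with involutions
`t i` satisfying the same braid relations. -/
theorem exists_equivariant_of_descents {W G B : Type*} [Group W] [Group G] [Finite W]
    (s : B → W) (t : B → G) (hs : ∀ i, s i * s i = 1) (ht : ∀ i, t i * t i = 1)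
    (D : B → W → Prop) (μ : W → ℝ)
    (hμ : ∀ i w, D i w → μ w < μ (s i * w)) (hD : ∀ i w, D i w ∨ D i (s i * w))
    (m : B → B → ℕ) (hm : ∀ i j, 0 < m i j)
    (hsm : ∀ i j, (s i * s j) ^ m i j = 1) (htm : ∀ i j, (t i * t j) ^ m i j = 1)
    (hdih : ∀ i j w, i ≠ j → D i w → D j w → ∀ l < m i j,
      D (altLetter i j l) ((altProd (s i) (s j) l)⁻¹ * w) ∧
      D (altLetter j i l) ((altProd (s j) (s i) l)⁻¹ * w)) :
    ∃ g : W → G, g 1 = 1 ∧ ∀ i w, g (s i * w) = t i * g w := by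
  classical
  -- The order is reversed: the recursion climbs towards larger `μ`.
  have wf : WellFounded (fun u w : W => μ w < μ u) := by
    have : IsTrans W (fun u w : W => μ w < μ u) := ⟨fun a b c h h' => h'.trans h⟩
    have : Std.Irrefl (fun u w : W => μ w < μ u) := ⟨fun a => lt_irrefl _⟩
    exact Finite.wellFounded_of_trans_of_irrefl _
  obtain ⟨g, hg⟩ : ∃ g : W → G, ∀ w, (∃ i, D i w) → ∃ i, D i w ∧ g w = t i * g (s i * w) := by
    refine ⟨wf.fix fun w F => if h : ∃ i, D i w then
      t h.choose * F (s h.choose * w) (hμ _ _ h.choose_spec) else 1, fun w h => ?_⟩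
    refine ⟨h.choose, h.choose_spec, ?_⟩
    rw [wf.fix_eq, dif_pos h]
  have key : ∀ w i, D i w → g w = t i * g (s i * w) := by
    intro w
    induction w using wf.induction with
    | _ w ih =>
    intro i hi
    obtain ⟨j, hj, hgj⟩ := hg w ⟨i, hi⟩
    rcases eq_or_ne i j with rfl | hij
    · exact hgj
    -- Strictly above `w` the induction hypothesis allows any descent, so a whole run of descents
    -- can be unwound.
    have chain : ∀ k i j u, μ w < μ u →
        (∀ l < k, D (altLetter i j l) ((altProd (s i) (s j) l)⁻¹ * u)) →
        g u = altProd (t i) (t j) k * g ((altProd (s i) (s j) k)⁻¹ * u) := by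
      intro k
      induction k with
      | zero => intro i j u _ _; simp [altProd]
      | succ k ihk =>
        intro i j u hu hl
        have h0 : D i u := by simpa [altLetter, altProd] using hl 0 (Nat.succ_pos k)
        have hsi : (s i)⁻¹ = s i := inv_eq_of_mul_eq_one_left (hs i)
        rw [ih u hu i h0, ihk j i (s i * u) (hu.trans (hμ i u h0)) ?_]
        · simp only [altProd, mul_inv_rev, hsi, mul_assoc]
        · intro l hlk
          have := hl (l + 1) (Nat.succ_lt_succ hlk)
          simpa only [altLetter, altProd, mul_inv_rev, hsi, mul_assoc] using this
    have full : ∀ i j, i ≠ j → D i w → D j w →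
        t i * g (s i * w) = altProd (t i) (t j) (m i j) *
          g ((altProd (s i) (s j) (m i j))⁻¹ * w) ∧
        t j * g (s j * w) = altProd (t j) (t i) (m i j) *
          g ((altProd (s j) (s i) (m i j))⁻¹ * w) := by
      intro i j hij hi hj
      have hsi : ∀ i, (s i)⁻¹ = s i := fun i => inv_eq_of_mul_eq_one_left (hs i)
      -- The first letter is split off because the induction hypothesis covers `s i * w` but not `w`
      -- itself.
      obtain ⟨k, hk⟩ : ∃ k, m i j = k + 1 := ⟨m i j - 1, by have := hm i j; omega⟩
      have hd := hdih i j w hij hi hj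
      rw [hk] at hd ⊢
      constructor
      · rw [chain k j i (s i * w) (hμ i w hi)]
        · simp only [altProd, mul_inv_rev, hsi, mul_assoc]
        · intro l hl
          simpa only [altLetter, altProd, mul_inv_rev, hsi, mul_assoc] using
            (hd (l + 1) (Nat.succ_lt_succ hl)).1
      · rw [chain k i j (s j * w) (hμ j w hj)]
        · simp only [altProd, mul_inv_rev, hsi, mul_assoc]
        · intro l hl
          simpa only [altLetter, altProd, mul_inv_rev, hsi, mul_assoc] using
            (hd (l + 1) (Nat.succ_lt_succ hl)).2
    obtain ⟨h1, h2⟩ := full i j hij hi hj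
    rw [hgj, h1, h2, altProd_comm (ht i) (ht j) (htm i j), altProd_comm (hs i) (hs j) (hsm i j)]
  have key' : ∀ i w, g (s i * w) = t i * g w := by
    intro i w
    rcases hD i w with h | h
    · rw [key w i h, ← mul_assoc, ht, one_mul]
    · rw [key _ i h, ← mul_assoc (s i), hs, one_mul]
  -- Right translation keeps equivariance and normalises the value at 1, which might itself have
  -- descents.
  exact ⟨fun w => g w * (g 1)⁻¹, mul_inv_cancel _, fun i w => by
    simp only [key', mul_assoc]⟩

/-! ### Reflections and positive roots -/

section PositiveRoots

open scoped RealInnerProductSpace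

variable {V : Type*} [NormedAddCommGroup V] [InnerProductSpace ℝ V] [FiniteDimensional ℝ V]

theorem IsHyperplane.exists_unit_normal {K : Submodule ℝ V} (hK : IsHyperplane K) :
    ∃ v : V, ‖v‖ = 1 ∧ (ℝ ∙ v)ᗮ = K := by
  have h1 := K.finrank_quotient_add_finrank
  have h2 := K.finrank_add_finrank_orthogonal
  have h3 : Module.finrank ℝ Kᗮ = 1 := by unfold IsHyperplane at hK; omega
  obtain ⟨w, hw, hspan⟩ := finrank_eq_one_iff'.1 h3
  have hw' : (w : V) ≠ 0 := by simpa using hw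
  refine ⟨‖(w : V)‖⁻¹ • (w : V), norm_smul_inv_norm hw', ?_⟩
  have : (ℝ ∙ (‖(w : V)‖⁻¹ • (w : V))) = Kᗮ := by
    rw [Submodule.span_singleton_smul_eq (by simpa using hw')]
    apply le_antisymm
    · simp [Submodule.span_singleton_le_iff_mem]
    · intro x hx
      obtain ⟨c, hc⟩ := hspan ⟨x, hx⟩
      exact Submodule.mem_span_singleton.2 ⟨c, by simpa using congrArg Subtype.val hc⟩
  rw [this, Submodule.orthogonal_orthogonal]

theorem hyperplaneReflection_orthogonal_apply {v : V} (hv : ‖v‖ = 1) (x : V) :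
    hyperplaneReflection (ℝ ∙ v)ᗮ x = x - (2 * ⟪v, x⟫) • v := by
  change (ℝ ∙ v)ᗮ.reflection x = _
  rw [Submodule.reflection_orthogonal_apply, Submodule.reflection_singleton_apply]
  simp [hv, two_mul, add_smul, two_smul]

theorem hyperplaneReflection_mul_self (K : Submodule ℝ V) :
    hyperplaneReflection K * hyperplaneReflection K = 1 := by
  ext x
  exact K.reflection_reflection x

theorem hyperplaneReflection_apply_self (K : Submodule ℝ V) (x : V) :
    hyperplaneReflection K (hyperplaneReflection K x) = x :=
  K.reflection_reflection x

theorem inner_hyperplaneReflection (K : Submodule ℝ V) (x y : V) :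
    ⟪hyperplaneReflection K x, y⟫ = ⟪x, hyperplaneReflection K y⟫ := by
  conv_lhs => rw [← hyperplaneReflection_apply_self K y]
  exact K.reflection.inner_map_map x _

theorem norm_hyperplaneReflection (K : Submodule ℝ V) (x : V) :
    ‖hyperplaneReflection K x‖ = ‖x‖ :=
  K.reflection.norm_map x

theorem hyperplaneReflection_eq_self_iff {K : Submodule ℝ V} {x : V} :
    hyperplaneReflection K x = x ↔ x ∈ K :=
  K.reflection_eq_self_iff x

theorem hyperplaneReflection_injective :
    Function.Injective (hyperplaneReflection : Submodule ℝ V → V ≃ₗ[ℝ] V) := by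
  intro K L h
  ext x
  rw [← hyperplaneReflection_eq_self_iff, h, hyperplaneReflection_eq_self_iff]

theorem map_hyperplaneReflection_orthogonal (K : Submodule ℝ V) (v : V) :
    ((ℝ ∙ v)ᗮ).map (hyperplaneReflection K : V →ₗ[ℝ] V) = (ℝ ∙ hyperplaneReflection K v)ᗮ := by
  ext x
  simp only [Submodule.mem_map, Submodule.mem_orthogonal_singleton_iff_inner_right]
  constructor
  · rintro ⟨y, hy, rfl⟩
    rw [inner_hyperplaneReflection, LinearEquiv.coe_coe, hyperplaneReflection_apply_self, hy]
  · intro hx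
    exact ⟨hyperplaneReflection K x, by rwa [← inner_hyperplaneReflection],
      hyperplaneReflection_apply_self K x⟩

theorem hyperplaneReflection_conj (K : Submodule ℝ V) {v : V} (hv : ‖v‖ = 1) :
    hyperplaneReflection (ℝ ∙ hyperplaneReflection K v)ᗮ =
      hyperplaneReflection K * hyperplaneReflection (ℝ ∙ v)ᗮ * hyperplaneReflection K := by
  ext x
  simp only [LinearEquiv.mul_apply]
  rw [hyperplaneReflection_orthogonal_apply hv,
    hyperplaneReflection_orthogonal_apply (by rwa [norm_hyperplaneReflection]), map_sub, map_smul,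
    hyperplaneReflection_apply_self, inner_hyperplaneReflection]

omit [FiniteDimensional ℝ V] in
theorem eq_of_orthogonal_eq {u v x : V} (hu : ‖u‖ = 1) (hv : ‖v‖ = 1)
    (h : (ℝ ∙ v)ᗮ ≤ (ℝ ∙ u)ᗮ) (hux : 0 < ⟪u, x⟫) (hvx : 0 < ⟪v, x⟫) : u = v := by
  have h' : (ℝ ∙ u) ≤ ℝ ∙ v := by
    have := Submodule.orthogonal_le h
    rwa [Submodule.orthogonal_orthogonal, Submodule.orthogonal_orthogonal] at this
  obtain ⟨c, rfl⟩ := Submodule.mem_span_singleton.1 (h' (Submodule.mem_span_singleton_self u))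
  rw [norm_smul, hv, mul_one, Real.norm_eq_abs] at hu
  rw [real_inner_smul_left] at hux
  have hc : 0 < c := pos_of_mul_pos_left hux hvx.le
  rw [abs_of_pos hc] at hu
  rw [hu, one_smul]

/-- A finite union of proper subspaces has dense complement; this supplies generic points of a
chamber. -/
theorem exists_near_inner_ne_zero (U : Set V) (hU : U.Finite) (h0 : ∀ u ∈ U, u ≠ 0) (O : Set V)
    (hO : IsOpen O) (hne : O.Nonempty) : ∃ z ∈ O, ∀ u ∈ U, ⟪u, z⟫ ≠ 0 := by
  have : CompleteSpace V := FiniteDimensional.complete ℝ V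
  have hd : Dense (⋂ u ∈ U, (((ℝ ∙ u)ᗮ : Submodule ℝ V) : Set V)ᶜ) := by
    refine dense_biInter_of_isOpen (fun u _ => (Submodule.isClosed_orthogonal _).isOpen_compl)
      hU.countable fun u hu => ?_
    rw [← interior_eq_empty_iff_dense_compl, ← Set.not_nonempty_iff_eq_empty]
    intro hi
    have := Submodule.eq_top_of_nonempty_interior' _ hi
    have hu' : u ∈ (ℝ ∙ u)ᗮ := this ▸ Submodule.mem_top
    rw [Submodule.mem_orthogonal_singleton_iff_inner_right, inner_self_eq_zero] at hu'
    exact h0 u hu hu'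
  obtain ⟨z, hz, hzU⟩ := hd.inter_open_nonempty O hO hne
  refine ⟨z, hz, fun u hu h => ?_⟩
  have := Set.mem_iInter₂.1 hzU u hu
  exact this (Submodule.mem_orthogonal_singleton_iff_inner_right.2 h)

/-- The unit normals of the members of `𝓗` which are positive at `p`. -/
def positiveRoots (𝓗 : Set (Submodule ℝ V)) (p : V) : Set V :=
  {v | ‖v‖ = 1 ∧ (ℝ ∙ v)ᗮ ∈ 𝓗 ∧ 0 < ⟪v, p⟫}

variable {𝓗 : Set (Submodule ℝ V)} {p : V}

theorem exists_positiveRoot (hp : p ∉ ⋃ K ∈ 𝓗, (K : Set V)) {K : Submodule ℝ V} (hK : K ∈ 𝓗)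
    (hK' : IsHyperplane K) : ∃ v ∈ positiveRoots 𝓗 p, (ℝ ∙ v)ᗮ = K := by
  obtain ⟨v, hv, rfl⟩ := hK'.exists_unit_normal
  have hvp : ⟪v, p⟫ ≠ 0 := fun h =>
    hp (Set.mem_biUnion hK (Submodule.mem_orthogonal_singleton_iff_inner_right.2 h))
  rcases hvp.lt_or_gt with h | h
  · have hs : (ℝ ∙ (-v)) = ℝ ∙ v := by
      rw [← Set.neg_singleton, Submodule.span_neg]
    exact ⟨-v, ⟨by rwa [norm_neg], by rwa [hs], by rw [inner_neg_left]; linarith⟩, by rw [hs]⟩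
  · exact ⟨v, ⟨hv, hK, h⟩, rfl⟩

theorem hyperplaneReflection_mem {K : Submodule ℝ V} (hK : K ∈ 𝓗) :
    hyperplaneReflection K ∈ reflectionGroup 𝓗 :=
  Subgroup.subset_closure (Set.mem_image_of_mem _ hK)

omit [FiniteDimensional ℝ V] in
theorem positiveRoots_eq_of_orthogonal_eq {u v : V} (hu : u ∈ positiveRoots 𝓗 p)
    (hv : v ∈ positiveRoots 𝓗 p) (h : (ℝ ∙ v)ᗮ ≤ (ℝ ∙ u)ᗮ) : u = v :=
  eq_of_orthogonal_eq hu.1 hv.1 h hu.2.2 hv.2.2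

theorem finite_positiveRoots (hfin : Finite (reflectionGroup 𝓗)) : (positiveRoots 𝓗 p).Finite := by
  refine Set.Finite.of_injOn (f := fun v => hyperplaneReflection (ℝ ∙ v)ᗮ)
    (t := (reflectionGroup 𝓗 : Set (V ≃ₗ[ℝ] V))) (fun v hv => hyperplaneReflection_mem hv.2.1)
    (fun u hu v hv h => ?_) (Set.toFinite _)
  exact positiveRoots_eq_of_orthogonal_eq hu hv (hyperplaneReflection_injective h).ge

end PositiveRoots

/-! ### Chambers, walls and simple roots -/

section Chambers

open scoped RealInnerProductSpace

variable {V : Type*} [NormedAddCommGroup V] [InnerProductSpace ℝ V] [FiniteDimensional ℝ V]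
variable {𝓗 : Set (Submodule ℝ V)} {p : V}

/-- A root cannot change sign on a connected set avoiding its hyperplane; conversely the positivity
region is convex. -/
theorem connectedComponentIn_compl_eq (hyp : ∀ K ∈ 𝓗, IsHyperplane K)
    (hp : p ∉ ⋃ K ∈ 𝓗, (K : Set V)) :
    connectedComponentIn (⋃ K ∈ 𝓗, (K : Set V))ᶜ p =
      {x | ∀ v ∈ positiveRoots 𝓗 p, 0 < ⟪v, x⟫} := by
  apply Set.Subset.antisymm
  · intro x hx v hv
    by_contra! hneg
    obtain ⟨z, hz, hz0⟩ := isPreconnected_connectedComponentIn.intermediate_value hx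
      (mem_connectedComponentIn hp) (f := fun z => ⟪v, z⟫) (by fun_prop) ⟨hneg, hv.2.2.le⟩
    exact connectedComponentIn_subset _ _ hz
      (Set.mem_biUnion hv.2.1 (Submodule.mem_orthogonal_singleton_iff_inner_right.2 hz0))
  · refine IsPreconnected.subset_connectedComponentIn ?_ (fun v hv => hv.2.2) ?_
    · apply Convex.isPreconnected
      intro x hx y hy a b ha hb hab v hv
      rw [inner_add_right, real_inner_smul_right, real_inner_smul_right]
      have h1 := hx v hv
      have h2 := hy v hv
      rcases ha.eq_or_lt with rfl | ha
      · have : b = 1 := by linarith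
        simpa [this] using h2
      · have := mul_pos ha h1
        have := mul_nonneg hb h2.le
        linarith
    · intro x hx hmem
      obtain ⟨K, hK, hxK⟩ := Set.mem_iUnion₂.1 hmem
      obtain ⟨v, hv, rfl⟩ := exists_positiveRoot hp hK (hyp K hK)
      exact (hx v hv).ne' (Submodule.mem_orthogonal_singleton_iff_inner_right.1 hxK)

/-- The positive roots of which the hyperplane is a wall of the chamber
on which the positive roots are positive. -/
def simpleRoots (𝓗 : Set (Submodule ℝ V)) (p : V) : Set V :=
  {v | v ∈ positiveRoots 𝓗 p ∧ (ℝ ∙ v)ᗮ ∈ walls 𝓗 {x | ∀ v ∈ positiveRoots 𝓗 p, 0 < ⟪v, x⟫}}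

omit [FiniteDimensional ℝ V] in
theorem inner_nonneg_of_mem_closure {v y : V} (hv : v ∈ positiveRoots 𝓗 p)
    (hy : y ∈ closure {x | ∀ v ∈ positiveRoots 𝓗 p, 0 < ⟪v, x⟫}) : 0 ≤ ⟪v, y⟫ := by
  have hc : IsClosed {x : V | 0 ≤ ⟪v, x⟫} := isClosed_le (by fun_prop) (by fun_prop)
  exact closure_minimal (fun x hx => (hx v hv).le) hc hy

-- The face spans the wall, so a positive root vanishing on the face has the same hyperplane as α
-- and equals it.
omit [FiniteDimensional ℝ V] in
theorem exists_mem_face_inner_pos {α β : V} (hα : α ∈ simpleRoots 𝓗 p)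
    (hβ : β ∈ positiveRoots 𝓗 p) (hne : β ≠ α) :
    ∃ y ∈ closure {x | ∀ v ∈ positiveRoots 𝓗 p, 0 < ⟪v, x⟫}, ⟪α, y⟫ = 0 ∧ 0 < ⟪β, y⟫ := by
  by_contra! hcon
  refine hne (positiveRoots_eq_of_orthogonal_eq hβ hα.1 ?_)
  rw [← hα.2.2, Submodule.span_le]
  rintro y ⟨hy, hyα⟩
  have h1 := hcon y hy (Submodule.mem_orthogonal_singleton_iff_inner_right.1 hyα)
  exact Submodule.mem_orthogonal_singleton_iff_inner_right.2
    (le_antisymm h1 (inner_nonneg_of_mem_closure hβ hy))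

omit [FiniteDimensional ℝ V] in
theorem inner_ne_zero_of_mem (hp : p ∉ ⋃ K ∈ 𝓗, (K : Set V)) {v : V} (hv : (ℝ ∙ v)ᗮ ∈ 𝓗) :
    ⟪v, p⟫ ≠ 0 := fun h =>
  hp (Set.mem_biUnion hv (Submodule.mem_orthogonal_singleton_iff_inner_right.2 h))

/-- The reflection fixes a face point where β is positive, so the image of β is positive there and
cannot be a negative root. -/
theorem hyperplaneReflection_mem_positiveRoots (hp : p ∉ ⋃ K ∈ 𝓗, (K : Set V))
    (inv : ∀ w ∈ reflectionGroup 𝓗, ∀ K ∈ 𝓗, K.map (w : V →ₗ[ℝ] V) ∈ 𝓗)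
    {α β : V} (hα : α ∈ simpleRoots 𝓗 p) (hβ : β ∈ positiveRoots 𝓗 p) (hne : β ≠ α) :
    hyperplaneReflection (ℝ ∙ α)ᗮ β ∈ positiveRoots 𝓗 p := by
  obtain ⟨y, hy, hαy, hβy⟩ := exists_mem_face_inner_pos hα hβ hne
  have hmem : (ℝ ∙ hyperplaneReflection (ℝ ∙ α)ᗮ β)ᗮ ∈ 𝓗 := by
    rw [← map_hyperplaneReflection_orthogonal]
    exact inv _ (hyperplaneReflection_mem hα.1.2.1) _ hβ.2.1
  have hnorm : ‖hyperplaneReflection (ℝ ∙ α)ᗮ β‖ = 1 := by rw [norm_hyperplaneReflection, hβ.1]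
  refine ⟨hnorm, hmem, ?_⟩
  refine (inner_ne_zero_of_mem hp hmem).lt_or_gt.resolve_left fun hlt => ?_
  have hneg : -hyperplaneReflection (ℝ ∙ α)ᗮ β ∈ positiveRoots 𝓗 p := by
    refine ⟨by rwa [norm_neg], ?_, by rw [inner_neg_left]; linarith⟩
    rwa [← Set.neg_singleton, Submodule.span_neg]
  have h1 := inner_nonneg_of_mem_closure hneg hy
  rw [inner_neg_left, inner_hyperplaneReflection, hyperplaneReflection_eq_self_iff.2
    (Submodule.mem_orthogonal_singleton_iff_inner_right.2 hαy)] at h1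
  linarith

-- Pairing with a point of the face of α isolates the coefficient of α'.
omit [FiniteDimensional ℝ V] in
theorem coeff_nonneg_of_positiveRoot {α α' β : V} (hα : α ∈ simpleRoots 𝓗 p)
    (hα' : α' ∈ positiveRoots 𝓗 p) (hne : α' ≠ α) (hβ : β ∈ positiveRoots 𝓗 p) {a b : ℝ}
    (h : β = a • α + b • α') : 0 ≤ b := by
  obtain ⟨y, hy, hαy, hpos⟩ := exists_mem_face_inner_pos hα hα' hne
  have h1 := inner_nonneg_of_mem_closure hβ hy
  rw [h, inner_add_left, real_inner_smul_left, real_inner_smul_left, hαy, mul_zero, zero_add] at h1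
  exact nonneg_of_mul_nonneg_left h1 hpos

omit [FiniteDimensional ℝ V] in
theorem inner_neg_of_mem_span_pair {α α' β x : V} (hα : α ∈ simpleRoots 𝓗 p)
    (hα' : α' ∈ simpleRoots 𝓗 p) (hne : α ≠ α') (hβ : β ∈ positiveRoots 𝓗 p)
    (hspan : β ∈ Submodule.span ℝ {α, α'}) (hx : ⟪α, x⟫ < 0) (hx' : ⟪α', x⟫ < 0) :
    ⟪β, x⟫ < 0 := by
  obtain ⟨a, b, rfl⟩ := Submodule.mem_span_pair.1 hspan
  have hb := coeff_nonneg_of_positiveRoot hα hα'.1 hne.symm hβ rfl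
  have ha := coeff_nonneg_of_positiveRoot hα' hα.1 hne hβ (add_comm _ _)
  rw [inner_add_left, real_inner_smul_left, real_inner_smul_left]
  rcases ha.eq_or_lt with rfl | ha
  · rcases hb.eq_or_lt with rfl | hb
    · have := hβ.1
      simp at this
    · have := mul_neg_of_pos_of_neg hb hx'
      linarith
  · have := mul_neg_of_pos_of_neg ha hx
    have := mul_nonpos_of_nonneg_of_nonpos hb hx'.le
    linarith

omit [FiniteDimensional ℝ V] in
/-- A positive root vanishing at a point at which the other positive roots are positive is simple. -/
theorem mem_simpleRoots_of_point (hfin : (positiveRoots 𝓗 p).Finite) {β y : V}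
    (hβ : β ∈ positiveRoots 𝓗 p) (hy : ⟪β, y⟫ = 0)
    (hpos : ∀ γ ∈ positiveRoots 𝓗 p, γ ≠ β → 0 < ⟪γ, y⟫) : β ∈ simpleRoots 𝓗 p := by
  refine ⟨hβ, hβ.2.1, le_antisymm (Submodule.span_le.2 Set.inter_subset_right) fun k hk => ?_⟩
  set C := {x | ∀ v ∈ positiveRoots 𝓗 p, 0 < ⟪v, x⟫} with hC
  have hk0 := Submodule.mem_orthogonal_singleton_iff_inner_right.1 hk
  have hclos : ∀ z, ⟪β, z⟫ = 0 → (∀ γ ∈ positiveRoots 𝓗 p, γ ≠ β → 0 < ⟪γ, z⟫) →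
      z ∈ Submodule.span ℝ (closure C ∩ ((ℝ ∙ β)ᗮ : Submodule ℝ V)) := by
    intro z hz hzpos
    refine Submodule.subset_span ⟨?_, Submodule.mem_orthogonal_singleton_iff_inner_right.2 hz⟩
    -- Moving slightly towards `p` makes β positive as well, so z is a limit of chamber points.
    have ht : Filter.Tendsto (fun δ : ℝ => z + δ • p) (nhdsWithin 0 (Set.Ioi 0)) (nhds z) := by
      have : Continuous (fun δ : ℝ => z + δ • p) := by fun_prop
      simpa using (this.tendsto 0).mono_left nhdsWithin_le_nhds
    refine mem_closure_of_tendsto ht ?_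
    filter_upwards [self_mem_nhdsWithin] with δ hδ v hv
    have h1 := mul_pos (Set.mem_Ioi.1 hδ) hv.2.2
    rw [inner_add_right, real_inner_smul_right]
    rcases eq_or_ne v β with rfl | hne
    · rwa [hz, zero_add]
    · have := hzpos v hv hne
      linarith
  have hev : ∀ᶠ ε in nhdsWithin (0 : ℝ) (Set.Ioi 0),
      ∀ γ ∈ positiveRoots 𝓗 p, γ ≠ β → 0 < ⟪γ, y + ε • k⟫ := by
    rw [Set.Finite.eventually_all hfin]
    intro γ hγ
    by_cases hne : γ = β
    · simp [hne]
    have hcont : Continuous (fun ε : ℝ => ⟪γ, y + ε • k⟫) := by fun_prop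
    have := (hcont.tendsto 0).mono_left (nhdsWithin_le_nhds (s := Set.Ioi 0))
    simp only [zero_smul, add_zero] at this
    filter_upwards [this.eventually_const_lt (hpos γ hγ hne)] with ε hε _ using hε
  obtain ⟨ε, hε, hε0⟩ := (hev.and self_mem_nhdsWithin).exists
  have hε0 : ε ≠ 0 := (Set.mem_Ioi.1 hε0).ne'
  -- Both y and y + εk lie in the face, so their difference puts k in its span.
  have h1 := hclos (y + ε • k) (by rw [inner_add_right, real_inner_smul_right, hy, hk0]; simp) hε
  have h2 := hclos y hy hpos
  have h3 := Submodule.smul_mem _ ε⁻¹ (Submodule.sub_mem _ h1 h2)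
  rwa [add_sub_cancel_left, smul_smul, inv_mul_cancel₀ hε0, one_smul] at h3

/-- On the segment from a generic chamber point z to x, the first hyperplane crossed is a wall. -/
theorem exists_simpleRoot_inner_neg (hfin : (positiveRoots 𝓗 p).Finite) {β x : V}
    (hβ : β ∈ positiveRoots 𝓗 p) (hx : ⟪β, x⟫ < 0) : ∃ α ∈ simpleRoots 𝓗 p, ⟪α, x⟫ < 0 := by
  set N := {γ | γ ∈ positiveRoots 𝓗 p ∧ ⟪γ, x⟫ < 0} with hN
  have hNfin : N.Finite := hfin.subset fun γ hγ => hγ.1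
  -- Pairing these vectors with z gives zero exactly when γ and δ vanish at the same point of the
  -- line through z and x.
  obtain ⟨z, hz, hgen⟩ := exists_near_inner_ne_zero
    ((fun q : V × V => ⟪q.2, x⟫ • q.1 - ⟪q.1, x⟫ • q.2) ''
      {q | q.1 ∈ N ∧ q.2 ∈ positiveRoots 𝓗 p ∧ q.2 ≠ q.1})
    (((hNfin.prod hfin).subset fun q hq => ⟨hq.1, hq.2.1⟩).image _) (by
      rintro _ ⟨⟨γ, δ⟩, ⟨hγ, hδ, hne⟩, rfl⟩ h0
      refine hne (positiveRoots_eq_of_orthogonal_eq hδ hγ.1 fun k hk => ?_)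
      rw [Submodule.mem_orthogonal_singleton_iff_inner_right] at hk ⊢
      have := congrArg (fun u => ⟪u, k⟫) h0
      simp only [inner_sub_left, real_inner_smul_left, inner_zero_left] at this hk
      rw [hk, mul_zero, zero_sub, neg_eq_zero] at this
      exact (mul_eq_zero.1 this).resolve_left hγ.2.ne)
    {x | ∀ v ∈ positiveRoots 𝓗 p, 0 < ⟪v, x⟫}
    (by
      have : {x | ∀ v ∈ positiveRoots 𝓗 p, 0 < ⟪v, x⟫} =
          ⋂ v ∈ positiveRoots 𝓗 p, {x : V | 0 < ⟪v, x⟫} := by ext; simp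
      rw [this]
      exact hfin.isOpen_biInter fun v _ => isOpen_lt (by fun_prop) (by fun_prop))
    ⟨p, fun v hv => hv.2.2⟩
  -- The minimised quotient is the time at which the segment crosses the hyperplane of γ.
  obtain ⟨γ, hγ, hmin⟩ := Set.exists_min_image N
    (fun γ => ⟪γ, z⟫ / (⟪γ, z⟫ - ⟪γ, x⟫)) hNfin ⟨β, hβ, hx⟩
  -- The witness is the crossing point, scaled by ⟪γ, z⟫ - ⟪γ, x⟫ > 0 to clear denominators.
  refine ⟨γ, mem_simpleRoots_of_point hfin (y := (-⟪γ, x⟫) • z + ⟪γ, z⟫ • x) hγ.1 ?_ ?_, hγ.2⟩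
  · simp only [inner_add_right, real_inner_smul_right]
    ring
  · intro δ hδ hne
    have hγz := hz γ hγ.1
    have hγx := hγ.2
    have hδz := hz δ hδ
    simp only [inner_add_right, real_inner_smul_right]
    rcases lt_or_ge ⟪δ, x⟫ 0 with hδx | hδx
    · have h1 := hmin δ ⟨hδ, hδx⟩
      rw [div_le_div_iff₀ (by linarith) (by linarith)] at h1
      have h2 := hgen _ ⟨(γ, δ), ⟨hγ, hδ, hne⟩, rfl⟩
      simp only [inner_sub_left, real_inner_smul_left] at h2
      refine lt_of_le_of_ne (by nlinarith) fun h => h2 (by linarith)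
    · have := mul_pos (neg_pos.2 hγx) hδz
      have := mul_nonneg hγz.le hδx
      linarith

end Chambers

theorem map_altProd {G N : Type*} [Group G] [Group N] (f : G →* N) (a b : G) (k : ℕ) :
    f (altProd a b k) = altProd (f a) (f b) k := by
  induction k generalizing a b with
  | zero => simp [altProd]
  | succ k ih => simp [altProd, ih]

/-! ### Generation by wall reflections -/

section Generation

open scoped RealInnerProductSpace

variable {V : Type*} [NormedAddCommGroup V] [InnerProductSpace ℝ V] [FiniteDimensional ℝ V]
variable {𝓗 : Set (Submodule ℝ V)} {p : V}

/-- Induction on ⟪β, p⟫. Since β is negative at s_β p, so is some simple α; this forces ⟪α, β⟫ > 0,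
and s_α lowers β. -/
theorem hyperplaneReflection_mem_closure_simpleRoots (hp : p ∉ ⋃ K ∈ 𝓗, (K : Set V))
    (inv : ∀ w ∈ reflectionGroup 𝓗, ∀ K ∈ 𝓗, K.map (w : V →ₗ[ℝ] V) ∈ 𝓗)
    (hfin : (positiveRoots 𝓗 p).Finite) {β : V} (hβ : β ∈ positiveRoots 𝓗 p) :
    hyperplaneReflection (ℝ ∙ β)ᗮ ∈
      Subgroup.closure ((fun α => hyperplaneReflection (ℝ ∙ α)ᗮ) '' simpleRoots 𝓗 p) := by
  have hwf : (positiveRoots 𝓗 p).WellFoundedOn (fun u v => ⟪u, p⟫ < ⟪v, p⟫) := by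
    have : IsTrans V (fun u v => ⟪u, p⟫ < ⟪v, p⟫) := ⟨fun a b c h h' => h.trans h'⟩
    have : Std.Irrefl (fun u v : V => ⟪u, p⟫ < ⟪v, p⟫) := ⟨fun a => lt_irrefl _⟩
    have : IsStrictOrder V (fun u v => ⟪u, p⟫ < ⟪v, p⟫) := {}
    exact hfin.wellFoundedOn
  refine hwf.induction (P := fun β => hyperplaneReflection (ℝ ∙ β)ᗮ ∈
    Subgroup.closure ((fun α => hyperplaneReflection (ℝ ∙ α)ᗮ) '' simpleRoots 𝓗 p)) hβ fun β hβ ih => ?_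
  have hneg : ⟪β, hyperplaneReflection (ℝ ∙ β)ᗮ p⟫ < 0 := by
    have := hβ.2.2
    rw [hyperplaneReflection_orthogonal_apply hβ.1, inner_sub_right, real_inner_smul_right,
      real_inner_self_eq_norm_sq, hβ.1]
    linarith
  obtain ⟨α, hα, hαneg⟩ := exists_simpleRoot_inner_neg hfin hβ hneg
  rcases eq_or_ne β α with rfl | hne
  · exact Subgroup.subset_closure ⟨β, hα, rfl⟩
  have hs : hyperplaneReflection (ℝ ∙ α)ᗮ ∈
      Subgroup.closure ((fun α => hyperplaneReflection (ℝ ∙ α)ᗮ) '' simpleRoots 𝓗 p) :=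
    Subgroup.subset_closure ⟨α, hα, rfl⟩
  have hpos : 0 < ⟪α, β⟫ := by
    rw [hyperplaneReflection_orthogonal_apply hβ.1, inner_sub_right, real_inner_smul_right]
      at hαneg
    have h1 := hα.1.2.2
    have h2 := hβ.2.2
    by_contra! h
    have := mul_nonpos_of_nonneg_of_nonpos h2.le h
    linarith
  have hlt : ⟪hyperplaneReflection (ℝ ∙ α)ᗮ β, p⟫ < ⟪β, p⟫ := by
    rw [hyperplaneReflection_orthogonal_apply hα.1.1, inner_sub_left, real_inner_smul_left]
    have := mul_pos hpos hα.1.2.2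
    linarith
  have h1 := ih _ (hyperplaneReflection_mem_positiveRoots hp inv hα hβ hne) hlt
  have h2 := mul_mem (mul_mem hs h1) hs
  rwa [← hyperplaneReflection_conj _ (by rw [norm_hyperplaneReflection, hβ.1]),
    hyperplaneReflection_apply_self] at h2

theorem closure_simpleRoots_eq (hyp : ∀ K ∈ 𝓗, IsHyperplane K) (hp : p ∉ ⋃ K ∈ 𝓗, (K : Set V))
    (inv : ∀ w ∈ reflectionGroup 𝓗, ∀ K ∈ 𝓗, K.map (w : V →ₗ[ℝ] V) ∈ 𝓗)
    (hfin : (positiveRoots 𝓗 p).Finite) :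
    Subgroup.closure ((fun α => hyperplaneReflection (ℝ ∙ α)ᗮ) '' simpleRoots 𝓗 p) =
      reflectionGroup 𝓗 := by
  apply le_antisymm
  · rw [Subgroup.closure_le]
    rintro _ ⟨α, hα, rfl⟩
    exact hyperplaneReflection_mem hα.1.2.1
  · unfold reflectionGroup
    rw [Subgroup.closure_le]
    rintro _ ⟨K, hK, rfl⟩
    obtain ⟨v, hv, rfl⟩ := exists_positiveRoot hp hK (hyp K hK)
    exact hyperplaneReflection_mem_closure_simpleRoots hp inv hfin hv

end Generation

/-! ### Roots along alternating words -/

section Dihedral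

open scoped RealInnerProductSpace

variable {V : Type*} [NormedAddCommGroup V] [InnerProductSpace ℝ V] [FiniteDimensional ℝ V]
variable {𝓗 : Set (Submodule ℝ V)} {p : V}

/-- The image of the letter at position `l` under the alternating product of `l` reflections. -/
noncomputable def altRoot : V → V → ℕ → V
  | α, _, 0 => α
  | α, α', l + 1 => hyperplaneReflection (ℝ ∙ α)ᗮ (altRoot α' α l)

theorem norm_altRoot {α α' : V} (hα : ‖α‖ = 1) (hα' : ‖α'‖ = 1) (l : ℕ) :
    ‖altRoot α α' l‖ = 1 := by
  induction l generalizing α α' with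
  | zero => exact hα
  | succ l ih => rw [altRoot, norm_hyperplaneReflection, ih hα' hα]

/-- Turns the descent condition after l letters into the sign of one root at the starting point. -/
theorem inner_altRoot {B : Type*} (α : B → V) (i j : B) (l : ℕ) (x : V) :
    ⟪α (altLetter i j l), (altProd (hyperplaneReflection (ℝ ∙ α i)ᗮ)
      (hyperplaneReflection (ℝ ∙ α j)ᗮ) l)⁻¹ x⟫ = ⟪altRoot (α i) (α j) l, x⟫ := by
  induction l generalizing i j x with
  | zero => simp [altLetter, altProd, altRoot]
  | succ l ih =>
    rw [altLetter, altProd, altRoot, mul_inv_rev, LinearEquiv.mul_apply, ih,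
      inner_hyperplaneReflection,
      inv_eq_of_mul_eq_one_left (hyperplaneReflection_mul_self (ℝ ∙ α i)ᗮ)]

theorem hyperplaneReflection_altRoot {α α' : V} (hα : ‖α‖ = 1) (hα' : ‖α'‖ = 1) (l : ℕ) :
    hyperplaneReflection (ℝ ∙ α')ᗮ * hyperplaneReflection (ℝ ∙ altRoot α α' l)ᗮ =
      (hyperplaneReflection (ℝ ∙ α')ᗮ * hyperplaneReflection (ℝ ∙ α)ᗮ) ^ (l + 1) := by
  induction l generalizing α α' with
  | zero => simp [altRoot]
  | succ l ih =>
    have h := ih hα' hα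
    rw [altRoot, hyperplaneReflection_conj _ (norm_altRoot hα' hα l), h, ← mul_assoc,
      mul_pow_mul_swap]

theorem altRoot_mem_span (α α' : V) (l : ℕ) (hα : ‖α‖ = 1) (hα' : ‖α'‖ = 1) :
    altRoot α α' l ∈ Submodule.span ℝ {α, α'} := by
  induction l generalizing α α' with
  | zero => exact Submodule.subset_span (by simp [altRoot])
  | succ l ih =>
    have h := ih α' α hα' hα
    rw [altRoot, hyperplaneReflection_orthogonal_apply hα]
    rw [Set.pair_comm] at h
    exact Submodule.sub_mem _ h (Submodule.smul_mem _ _ (Submodule.subset_span (by simp)))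

/-- Each reflection keeps the root positive unless it meets its own simple root; that would give
(s_α s_α')^(l+1) = 1 below the order. -/
theorem altRoot_mem_positiveRoots (hp : p ∉ ⋃ K ∈ 𝓗, (K : Set V))
    (inv : ∀ w ∈ reflectionGroup 𝓗, ∀ K ∈ 𝓗, K.map (w : V →ₗ[ℝ] V) ∈ 𝓗)
    {α α' : V} (hα : α ∈ simpleRoots 𝓗 p) (hα' : α' ∈ simpleRoots 𝓗 p) {l : ℕ}
    (hl : l < orderOf (hyperplaneReflection (ℝ ∙ α)ᗮ * hyperplaneReflection (ℝ ∙ α')ᗮ)) :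
    altRoot α α' l ∈ positiveRoots 𝓗 p := by
  induction l generalizing α α' with
  | zero => exact hα.1
  | succ l ih =>
    have hord : orderOf (hyperplaneReflection (ℝ ∙ α')ᗮ * hyperplaneReflection (ℝ ∙ α)ᗮ) =
        orderOf (hyperplaneReflection (ℝ ∙ α)ᗮ * hyperplaneReflection (ℝ ∙ α')ᗮ) := by
      rw [← orderOf_inv, mul_inv_rev, inv_eq_of_mul_eq_one_left (hyperplaneReflection_mul_self _),
        inv_eq_of_mul_eq_one_left (hyperplaneReflection_mul_self _)]
    refine hyperplaneReflection_mem_positiveRoots hp inv hα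
      (ih hα' hα (by rw [hord]; omega)) fun heq => ?_
    have h := hyperplaneReflection_altRoot hα'.1.1 hα.1.1 l
    rw [heq, hyperplaneReflection_mul_self] at h
    exact absurd (Nat.le_of_dvd (Nat.succ_pos l) (orderOf_dvd_of_pow_eq_one h.symm)) (by omega)

end Dihedral

/-! ### The Coxeter presentation -/

section Presentation

open scoped RealInnerProductSpace

variable {V : Type*} [NormedAddCommGroup V] [InnerProductSpace ℝ V] [FiniteDimensional ℝ V]
variable {𝓗 : Set (Submodule ℝ V)} {C : Set V} {r : ℕ} {H : Fin r → Submodule ℝ V}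

theorem IsReflectionChamber.exists_simpleRoots (h : IsReflectionChamber 𝓗 C H) :
    ∃ p : V, p ∉ ⋃ K ∈ 𝓗, (K : Set V) ∧ ∃ α : Fin r → V, (∀ i, α i ∈ simpleRoots 𝓗 p) ∧
      (∀ i, (ℝ ∙ α i)ᗮ = H i) ∧ Function.Injective α ∧ Set.range α = simpleRoots 𝓗 p := by
  obtain ⟨p, hp, hC⟩ := h.chamber
  rw [connectedComponentIn_compl_eq h.hyperplane hp] at hC
  have hw : ∀ i, H i ∈ walls 𝓗 C := fun i => h.range_eq ▸ Set.mem_range_self i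
  choose α hα hαH using fun i => exists_positiveRoot hp (hw i).1 (h.hyperplane _ (hw i).1)
  have hs : ∀ i, α i ∈ simpleRoots 𝓗 p := fun i => ⟨hα i, by rw [hαH, ← hC]; exact hw i⟩
  refine ⟨p, hp, α, hs, hαH, fun i j hij => h.injective (by rw [← hαH, hij, hαH]),
    Set.Subset.antisymm (Set.range_subset_iff.2 hs) fun v hv => ?_⟩
  have hv2 := hv.2
  rw [← hC, ← h.range_eq] at hv2
  obtain ⟨i, hi⟩ := hv2
  exact ⟨i, positiveRoots_eq_of_orthogonal_eq (hα i) hv.1 (by rw [hαH, hi])⟩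

theorem isCoxeter_reflectionOrderMatrix (hH : Function.Injective H) :
    (reflectionOrderMatrix H).IsSymm ∧ (∀ i, reflectionOrderMatrix H i i = 1) ∧
      ∀ i j, i ≠ j → reflectionOrderMatrix H i j ≠ 1 := by
  refine ⟨?_, fun i => ?_, fun i j hij h => hij (hH (hyperplaneReflection_injective ?_))⟩
  · ext i j
    simp only [reflectionOrderMatrix, Matrix.transpose_apply, Matrix.of_apply]
    rw [← orderOf_inv, mul_inv_rev, inv_eq_of_mul_eq_one_left (hyperplaneReflection_mul_self _),
      inv_eq_of_mul_eq_one_left (hyperplaneReflection_mul_self _)]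
  · simp [reflectionOrderMatrix, hyperplaneReflection_mul_self]
  · simp only [reflectionOrderMatrix, Matrix.of_apply, orderOf_eq_one_iff] at h
    rw [eq_inv_of_mul_eq_one_left h,
      inv_eq_of_mul_eq_one_left (hyperplaneReflection_mul_self _)]

theorem IsReflectionChamber.exists_coxeterSystem (h : IsReflectionChamber 𝓗 C H) :
    ∃ M : CoxeterMatrix (Fin r), M.M = reflectionOrderMatrix H ∧
      ∃ cs : CoxeterSystem M (reflectionGroup 𝓗),
        ∀ i, (cs.simple i : V ≃ₗ[ℝ] V) = hyperplaneReflection (H i) := by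
  have hM := isCoxeter_reflectionOrderMatrix h.injective
  let M : CoxeterMatrix (Fin r) := ⟨reflectionOrderMatrix H, hM.1, hM.2.1, hM.2.2⟩
  have : Finite (reflectionGroup 𝓗) := h.finite
  obtain ⟨p, hp, α, hα, hαH, hinj, hrange⟩ := h.exists_simpleRoots
  have hfin := finite_positiveRoots (p := p) h.finite
  let s : Fin r → reflectionGroup 𝓗 := fun i =>
    ⟨hyperplaneReflection (ℝ ∙ α i)ᗮ, hyperplaneReflection_mem (hα i).1.2.1⟩
  have hs : ∀ i, s i * s i = 1 := fun i => Subtype.ext (hyperplaneReflection_mul_self _)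
  have hord : ∀ i j, orderOf (s i * s j) = M i j := fun i j => by
    rw [← Subgroup.orderOf_coe]
    change _ = orderOf _
    rw [← hαH, ← hαH]
    rfl
  have hsm : ∀ i j, (s i * s j) ^ M i j = 1 := fun i j => by
    rw [← hord]
    exact pow_orderOf_eq_one _
  let f : M.Group →* reflectionGroup 𝓗 := M.toCoxeterSystem.lift ⟨s, hsm⟩
  have hf : ∀ i, f (M.simple i) = s i := M.toCoxeterSystem.lift_apply_simple hsm
  -- By invariance the orbit of `p` avoids every hyperplane, so each i is a descent of w or of s_i
  -- w.
  have hpW : ∀ i (w : reflectionGroup 𝓗), ⟪α i, (w : V ≃ₗ[ℝ] V) p⟫ ≠ 0 := fun i w h0 => by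
    have h1 := h.invariant _ (inv_mem w.2) _ (hα i).1.2.1
    refine hp (Set.mem_biUnion h1 ⟨(w : V ≃ₗ[ℝ] V) p,
      Submodule.mem_orthogonal_singleton_iff_inner_right.2 h0, ?_⟩)
    exact (w : V ≃ₗ[ℝ] V).symm_apply_apply p
  have hdih : ∀ (i j : Fin r) (w : reflectionGroup 𝓗), i ≠ j →
      ⟪α i, (w : V ≃ₗ[ℝ] V) p⟫ < 0 → ⟪α j, (w : V ≃ₗ[ℝ] V) p⟫ < 0 → ∀ l < M i j,
      ⟪α (altLetter i j l), (((altProd (s i) (s j) l)⁻¹ * w : reflectionGroup 𝓗) : V ≃ₗ[ℝ] V) p⟫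
        < 0 := by
    intro i j w hij hi hj l hl
    have hcoe := map_altProd (reflectionGroup 𝓗).subtype (s i) (s j) l
    simp only [Subgroup.coe_subtype] at hcoe
    rw [Subgroup.coe_mul, Subgroup.coe_inv, hcoe, LinearEquiv.mul_apply, inner_altRoot]
    refine inner_neg_of_mem_span_pair (hα i) (hα j) (hinj.ne hij) ?_
      (altRoot_mem_span _ _ l (hα i).1.1 (hα j).1.1) hi hj
    refine altRoot_mem_positiveRoots hp h.invariant (hα i) (hα j) ?_
    rw [← hord, ← Subgroup.orderOf_coe] at hl
    exact hl
  obtain ⟨g, hg1, hg⟩ := exists_equivariant_of_descents (G := M.Group) s M.simple hs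
    M.toCoxeterSystem.simple_mul_simple_self
    (fun i w => ⟪α i, (w : V ≃ₗ[ℝ] V) p⟫ < 0) (fun w => ⟪(w : V ≃ₗ[ℝ] V) p, p⟫)
    -- The increase is -2⟪α_i, w p⟫⟪α_i, p⟫, a positive number.
    (fun i w hw => by
      have := mul_neg_of_neg_of_pos hw (hα i).1.2.2
      simp only [s, Subgroup.coe_mul, LinearEquiv.mul_apply]
      rw [hyperplaneReflection_orthogonal_apply (hα i).1.1, inner_sub_left, real_inner_smul_left]
      linarith)
    (fun i w => by
      simp only [s, Subgroup.coe_mul, LinearEquiv.mul_apply]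
      rw [hyperplaneReflection_orthogonal_apply (hα i).1.1, inner_sub_right,
        real_inner_smul_right, real_inner_self_eq_norm_sq, (hα i).1.1]
      rcases (hpW i w).lt_or_gt with h | h
      · exact Or.inl h
      · exact Or.inr (by linarith))
    (fun i j => M i j)
    (fun i j => by rw [← hord]; exact orderOf_pos _)
    hsm M.toCoxeterSystem.simple_mul_simple_pow
    (fun i j w hij hi hj l hl => ⟨hdih i j w hij hi hj l hl,
      hdih j i w hij.symm hj hi l (by rwa [M.symmetric] at hl)⟩)
  -- Equivariance and g 1 = 1 give g ∘ f = id by induction on words, hence injectivity of `f`.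
  have hgf : ∀ w, g (f w) = w := fun w => by
    refine M.toCoxeterSystem.simple_induction_left
      (p := fun w => g (f w) = w) w (by rw [map_one, hg1]) fun w i ih => ?_
    rw [map_mul]
    change g (f (M.simple i) * f w) = M.simple i * w
    rw [hf, hg, ih]
  have hsurj : Function.Surjective f := by
    rw [← MonoidHom.range_eq_top, eq_top_iff]
    have hmap : reflectionGroup 𝓗 ≤ f.range.map (reflectionGroup 𝓗).subtype := by
      conv_lhs => rw [← closure_simpleRoots_eq h.hyperplane hp h.invariant hfin]
      rw [Subgroup.closure_le, ← hrange]
      rintro _ ⟨_, ⟨i, rfl⟩, rfl⟩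
      exact ⟨s i, ⟨M.simple i, hf i⟩, rfl⟩
    intro w _
    obtain ⟨w', hw', heq⟩ := hmap w.2
    rwa [← Subtype.ext heq]
  let e : M.Group ≃* reflectionGroup 𝓗 :=
    MulEquiv.ofBijective f ⟨Function.LeftInverse.injective hgf, hsurj⟩
  refine ⟨M, rfl, ⟨e.symm⟩, fun i => ?_⟩
  change ((f (M.simple i) : reflectionGroup 𝓗) : V ≃ₗ[ℝ] V) = _
  rw [hf, ← hαH]

end Presentation

theorem mainTheorem2 {V V' : Type*}
    [NormedAddCommGroup V] [InnerProductSpace ℝ V] [FiniteDimensional ℝ V]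
    [NormedAddCommGroup V'] [InnerProductSpace ℝ V'] [FiniteDimensional ℝ V'] {r : ℕ} :
    -- `W` has the Coxeter presentation on the wall reflections with matrix `M = (m_ij)`
    (∀ (𝓗 : Set (Submodule ℝ V)) (C : Set V) (H : Fin r → Submodule ℝ V),
      IsReflectionChamber 𝓗 C H →
      ∃ M : CoxeterMatrix (Fin r), M.M = reflectionOrderMatrix H ∧
        ∃ cs : CoxeterSystem M (reflectionGroup 𝓗),
          ∀ i, (cs.simple i : V ≃ₗ[ℝ] V) = hyperplaneReflection (H i)) ∧
    -- two such groups with the same matrix are isomorphic, matching up the wall reflections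
    (∀ (𝓗 : Set (Submodule ℝ V)) (C : Set V) (H : Fin r → Submodule ℝ V)
      (𝓗' : Set (Submodule ℝ V')) (C' : Set V') (H' : Fin r → Submodule ℝ V'),
      IsReflectionChamber 𝓗 C H → IsReflectionChamber 𝓗' C' H' →
      reflectionOrderMatrix H = reflectionOrderMatrix H' →
      ∃ φ : reflectionGroup 𝓗 ≃* reflectionGroup 𝓗',
        ∀ (i : Fin r) (w : reflectionGroup 𝓗),
          (w : V ≃ₗ[ℝ] V) = hyperplaneReflection (H i) →
            (φ w : V' ≃ₗ[ℝ] V') = hyperplaneReflection (H' i)) := by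
  refine ⟨fun 𝓗 C H h => h.exists_coxeterSystem, fun 𝓗 C H 𝓗' C' H' h h' hHH => ?_⟩
  obtain ⟨M, hM, cs, hcs⟩ := h.exists_coxeterSystem
  obtain ⟨M', hM', cs', hcs'⟩ := h'.exists_coxeterSystem
  obtain rfl : M = M' := CoxeterMatrix.ext (hM.trans (hHH.trans hM'.symm))
  refine ⟨cs.mulEquiv.trans cs'.mulEquiv.symm, fun i w hw => ?_⟩
  obtain rfl : w = cs.simple i := Subtype.ext (hw.trans (hcs i).symm)
  rw [← hcs' i]
  exact congrArg (fun x => (cs'.mulEquiv.symm x : V' ≃ₗ[ℝ] V'))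
    (cs.mulEquiv.apply_symm_apply _)
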